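/- Let $M\subseteq\mathbb{R}^n$ be a smooth embedded $k$-dimensional submanifold (without boundary) that is a closed subset of $\mathbb{R}^n$. Let $\rho\in[0,\infty]$ be its normal injectivity radius, i.e. the supremum of the $r\ge 0$ for which $(x,v)\mapsto x+v$ is a diffeomorphism from $\{(x,v): x\in M,\ v\perp T_xM,\ |v|<r\}$ onto an open subset of $\mathbb{R}^n$. Let $r(y)=\mathrm{dist}(y,M)$ and, for $0<s<\rho$, let $M^s=\{y\in\mathbb{R}^n : r(y)=s\}$. For a submanifold with vector-valued second fundamental form $A$ and a normal vector $\xi$ put $A^{\xi}(v,w)=\langle A(v,w),\xi\rangle$; a principal direction with principal curvature $\kappa$ with respect to $\xi$ is a tangent vector $v\ne0$ with $A^\xi(v,w)=\kappa\langle v,w\rangle$ for all tangent vectors $w$. For every $0<s<\rho$ the level set $M^s$ is a smooth hypersurface; let $A^s$ be its second fundamental form with respect to the interior unit normal (the one pointing into $\{r<s\}$). Let $x\in M$, let $\nu$ be a unit vector normal to $M$ at $x$, and let $P=T_xM$ and $Q=(P\oplus\mathbb{R}\nu)^\perp$. Then $P$ has an orthonormal basis consisting of principal directions of $M$ at $x$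 with respect to $-\nu$, and for every $0<s<\rho$ we have $x+s\nu\in M^s$, $T_{x+s\nu}M^s=P\oplus Q$, the interior unit normal of $M^s$ at $x+s\nu$ is $-\nu$, and the following hold at $x+s\nu$. 1. The principal directions of $M^s$ at $x+s\nu$ (with respect to the interior normal) do not depend on $s\in(0,\rho)$, and each of them lies in $P$ or in $Q$. 2. $A^s(q,w)=\frac1s\langle q,w\rangle$ for all $q\in Q$ and $w\in P\oplus Q$. 3. If $v\in P$ is a principal direction of $M$ at $x$ with respect to $-\nu$, with principal curvature $\beta$, then $1+s\beta>0$ and $v$ is a principal direction of $M^s$ at $x+s\nu$ with principal curvature $\frac{\beta}{1+s\beta}$; in particular $A^s(v,v)=\frac{\beta}{1+s\beta}$ if $|v|=1$. 4. $A^s(v,v)<\frac1s$ for every $v\in P$ with $|v|=1$. Moreover, for every finite $\delta<\rho$ there is a constant $C$ such that $|A^s(v,w)|\le C|v||w|$ at $x+s\nu$ for all $0<s\le\delta$, all $x\in M$, all unit normal vectors $\nu$ of $M$ at $x$, and all $v,w\in T_xM$. -/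

import Mathlib

open scoped ContDiff Topology ENNReal NNReal

noncomputable section

namespace Tub

/-- `M ⊆ ℝⁿ` is a smooth (embedded, boundaryless) `k`-dimensional submanifold: around each of its
points a smooth diffeomorphism between open subsets of `ℝⁿ` straightens `M` to a `k`-dimensional
linear subspace. -/
def IsSmoothSubmanifold {n : ℕ} (k : ℕ) (M : Set (EuclideanSpace ℝ (Fin n))) : Prop :=
  ∀ x ∈ M, ∃ (e : OpenPartialHomeomorph (EuclideanSpace ℝ (Fin n)) (EuclideanSpace ℝ (Fin n)))
    (W : Submodule ℝ (EuclideanSpace ℝ (Fin n))),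
    x ∈ e.source ∧ ContDiffOn ℝ ∞ e e.source ∧ ContDiffOn ℝ ∞ e.symm e.target ∧
      Module.finrank ℝ W = k ∧ ∀ y ∈ e.source, y ∈ M ↔ e y ∈ W

/-- The tangent space `T_x M`, as a linear subspace of `ℝⁿ`: the velocities at `x` of the smooth
curves in `M` through `x` (for a submanifold these already form a subspace, so that taking the
span adds nothing). -/
def tangentSpace {n : ℕ} (M : Set (EuclideanSpace ℝ (Fin n))) (x : EuclideanSpace ℝ (Fin n)) :
    Submodule ℝ (EuclideanSpace ℝ (Fin n)) :=
  Submodule.span ℝ {v | ∃ (γ : ℝ → EuclideanSpace ℝ (Fin n)) (ε : ℝ), 0 < ε ∧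
    ContDiffOn ℝ ∞ γ (Set.Ioo (-ε) ε) ∧ (∀ t ∈ Set.Ioo (-ε) ε, γ t ∈ M) ∧
      γ 0 = x ∧ HasDerivAt γ v 0}

/-- The vector-valued second fundamental form `A(v, w) = (D_v W)^⊥` of `M` at `x`, for
`v, w ∈ T_x M`. Here `W` is a tangent vector field on `M` with `W x = w`; we take the tangential
projection of the constant field `w`. The derivative is taken along `M`; on tangent
vectors `v` it does not depend on how it is continued to the other directions. -/
def secondFundamentalForm {n : ℕ} (M : Set (EuclideanSpace ℝ (Fin n)))
    (x v w : EuclideanSpace ℝ (Fin n)) : EuclideanSpace ℝ (Fin n) :=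
  (tangentSpace M x)ᗮ.starProjection
    (fderivWithin ℝ (fun y => (tangentSpace M y).starProjection w) M x v)

/-- The scalar second fundamental form `A^ξ(v, w) = ⟨A(v, w), ξ⟩` in the normal direction `ξ`. -/
def sffAlong {n : ℕ} (M : Set (EuclideanSpace ℝ (Fin n)))
    (x ξ v w : EuclideanSpace ℝ (Fin n)) : ℝ :=
  inner ℝ (secondFundamentalForm M x v w) ξ

/-- `v` is a principal direction of `M` at `x` with respect to the normal `ξ`, with principal
curvature `κ`: a nonzero tangent vector with `A^ξ(v, ·) = κ ⟨v, ·⟩` on `T_x M`. -/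
def IsPrincipalDirection {n : ℕ} (M : Set (EuclideanSpace ℝ (Fin n)))
    (x ξ v : EuclideanSpace ℝ (Fin n)) (κ : ℝ) : Prop :=
  v ∈ tangentSpace M x ∧ v ≠ 0 ∧ ∀ w ∈ tangentSpace M x, sffAlong M x ξ v w = κ * inner ℝ v w

/-- The open disc bundle of radius `r` in the normal bundle of `M`. -/
def normalDiscBundle {n : ℕ} (M : Set (EuclideanSpace ℝ (Fin n))) (r : ℝ) :
    Set (EuclideanSpace ℝ (Fin n) × EuclideanSpace ℝ (Fin n)) :=
  {p | p.1 ∈ M ∧ p.2 ∈ (tangentSpace M p.1)ᗮ ∧ ‖p.2‖ < r}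

/-- The normal exponential map `(x, v) ↦ x + v` of a submanifold of `ℝⁿ`. -/
def normalExp {n : ℕ} (p : EuclideanSpace ℝ (Fin n) × EuclideanSpace ℝ (Fin n)) :
    EuclideanSpace ℝ (Fin n) :=
  p.1 + p.2

/-- The normal exponential map restricts to a diffeomorphism from the normal disc bundle of
radius `r` onto an open subset of `ℝⁿ`, that is, it has a smooth inverse on its open image. -/
def IsNormalDiffeoRadius {n : ℕ} (M : Set (EuclideanSpace ℝ (Fin n))) (r : ℝ) : Prop :=
  IsOpen (normalExp '' normalDiscBundle M r) ∧
    ∃ G : EuclideanSpace ℝ (Fin n) → EuclideanSpace ℝ (Fin n) × EuclideanSpace ℝ (Fin n),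
      ContDiffOn ℝ ∞ G (normalExp '' normalDiscBundle M r) ∧
        ∀ p ∈ normalDiscBundle M r, G (normalExp p) = p

/-- The normal injectivity radius of `M` (which is `∞` for an affine subspace). -/
def normalInjectivityRadius {n : ℕ} (M : Set (EuclideanSpace ℝ (Fin n))) : ℝ≥0∞ :=
  ⨆ (r : ℝ≥0) (_ : IsNormalDiffeoRadius M (r : ℝ)), (r : ℝ≥0∞)

/-- The level set `M^s` of the distance function from `M`. -/
def distLevel {n : ℕ} (M : Set (EuclideanSpace ℝ (Fin n))) (s : ℝ) :
    Set (EuclideanSpace ℝ (Fin n)) :=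
  {y | Metric.infDist y M = s}

/-- `η` is the interior unit normal of `M^s` at `y`: a unit normal that points into the
sublevel set of points at distance less than `s` from `M`. -/
def IsInteriorUnitNormal {n : ℕ} (M : Set (EuclideanSpace ℝ (Fin n))) (s : ℝ)
    (y η : EuclideanSpace ℝ (Fin n)) : Prop :=
  ‖η‖ = 1 ∧ η ∈ (tangentSpace (distLevel M s) y)ᗮ ∧
    ∀ᶠ t in 𝓝[>] (0 : ℝ), Metric.infDist (y + t • η) M < s

end Tub

end

/-!
Fix a radius `r` for which the normal exponential map is a diffeomorphism. Since `M` is closed,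
every point at distance less than `r` has a nearest point, and it sees that point in a normal
direction. Hence the image of the normal disc bundle is the `r`-neighbourhood of `M`, and the
inverse is given by the smooth nearest point projection `π`, with `|y - π y| = dist(y, M)`
(`IsNormalDiffeoRadius.exists_isTubularProjection`). Everything is read off from `Dπ` at
`y = x + sν`.

* The squared distance has gradient `2 (y - π y)` and Hessian `2 (1 - Dπ)`. So `Dπ` is symmetric,
  `M^s` is a regular level set with normal `ν`, and its second fundamental form is
  `A^s(v, w) = ⟨v - Dπ v, w⟩ / s` (`IsTubularProjection.sffAlong_distLevel`).
* `π` is constant along normal discs, so `Dπ = 0` on the normal space of `M`.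
* Differentiating the statement that `y - π y` is normal to `M` at `π y` gives
  `(1 + s S) Dπ = 1` on `T_x M`, where `S` is the shape operator of `M` in the direction `-ν`
  (`IsTubularProjection.inner_fderiv_add_sffAlong`). On a principal direction with curvature `β`
  this says `(1 + sβ) Dπ v = v`, so that `A^s(v, ·) = β / (1 + sβ) ⟨v, ·⟩`.

The identity `(1 + tβ) Dπ v = v` holds for all `|t| < r`, of either sign, so `1 + tβ` vanishes for
none of them and `|β| ≤ 1 / r`. Therefore `1 + sβ > 0` for `0 < s < r`, and on the part `s ≤ δ < r`
of the tube `|β / (1 + sβ)| ≤ 1 / (r - δ)`, which is the uniform bound.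

That `M` has an orthonormal basis of principal directions, whatever its normal injectivity radius,
is a local fact. If `ρ` is a smooth retraction onto `M` near `x`, then `T_y M` is the range of the
idempotent operator `Dρ(y)` for `y ∈ M`, and the second fundamental form is the normal part of
`D²ρ(x)` (`IsSmoothRetraction.sffAlong_eq`). So it is symmetric, and the spectral theorem applies.
-/

noncomputable section

namespace Tub

variable {n k : ℕ} {M : Set (EuclideanSpace ℝ (Fin n))}

/-! ### Tangent vectors -/

/-- Linear maps that agree on velocities of curves in `M` agree on the tangent space; so a
derivative of `f` within `M` is determined there, although `M` has no unique differentials. -/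
theorem fderivWithin_eq_of_mem_tangentSpace {F : Type*} [NormedAddCommGroup F] [NormedSpace ℝ F]
    {f : EuclideanSpace ℝ (Fin n) → F} {f' : EuclideanSpace ℝ (Fin n) →L[ℝ] F}
    {x v : EuclideanSpace ℝ (Fin n)} (hf : HasFDerivWithinAt f f' M x)
    (hv : v ∈ tangentSpace M x) : fderivWithin ℝ f M x v = f' v := by
  have hle : tangentSpace M x ≤ LinearMap.eqLocus
      (fderivWithin ℝ f M x : EuclideanSpace ℝ (Fin n) →ₗ[ℝ] F) f' := by
    refine Submodule.span_le.2 ?_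
    rintro v ⟨γ, ε, hε, -, hM, h0, hd⟩
    have hev : ∀ᶠ t in 𝓝 (0 : ℝ), γ t ∈ M :=
      Filter.eventually_of_mem (Ioo_mem_nhds (neg_lt_zero.2 hε) hε) hM
    have h1 := hf.differentiableWithinAt.hasFDerivWithinAt.comp_hasDerivAt_of_eq (0 : ℝ) hd hev
      h0.symm
    have h2 := hf.comp_hasDerivAt_of_eq (0 : ℝ) hd hev h0.symm
    exact h1.unique h2
  exact hle hv

/-- A map that is constant on `M` has zero differential on tangent vectors. -/
theorem fderiv_eq_zero_of_mem_tangentSpace {F : Type*} [NormedAddCommGroup F] [NormedSpace ℝ F]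
    {f : EuclideanSpace ℝ (Fin n) → F} {f' : EuclideanSpace ℝ (Fin n) →L[ℝ] F} {c : F}
    {x v : EuclideanSpace ℝ (Fin n)} (hf : HasFDerivWithinAt f f' M x) (hx : x ∈ M)
    (hc : ∀ y ∈ M, f y = c) (hv : v ∈ tangentSpace M x) : f' v = 0 := by
  have h : HasFDerivWithinAt f (0 : EuclideanSpace ℝ (Fin n) →L[ℝ] F) M x :=
    (hasFDerivWithinAt_const c x M).congr hc (hc x hx)
  rw [← fderivWithin_eq_of_mem_tangentSpace hf hv, fderivWithin_eq_of_mem_tangentSpace h hv]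
  rfl

/-- The image of the differential of a smooth map into `M` consists of tangent vectors. -/
theorem fderiv_mem_tangentSpace {V : Set (EuclideanSpace ℝ (Fin n))}
    {r : EuclideanSpace ℝ (Fin n) → EuclideanSpace ℝ (Fin n)} (hV : IsOpen V)
    (hr : ContDiffOn ℝ ∞ r V) (hrM : ∀ y ∈ V, r y ∈ M) {y : EuclideanSpace ℝ (Fin n)}
    (hy : y ∈ V) (v : EuclideanSpace ℝ (Fin n)) :
    fderiv ℝ r y v ∈ tangentSpace M (r y) := by
  have hline : ContDiff ℝ ∞ fun t : ℝ => y + t • v := by fun_prop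
  have hpre : (fun t : ℝ => y + t • v) ⁻¹' V ∈ 𝓝 (0 : ℝ) :=
    hline.continuous.continuousAt.preimage_mem_nhds (by simpa using hV.mem_nhds hy)
  obtain ⟨ε, hε, hball⟩ := Metric.mem_nhds_iff.1 hpre
  rw [Real.ball_eq_Ioo, zero_sub, zero_add] at hball
  refine Submodule.subset_span ⟨fun t => r (y + t • v), ε, hε,
    hr.comp hline.contDiffOn hball, fun t ht => hrM _ (hball ht), by simp, ?_⟩
  have hd : HasDerivAt (fun t : ℝ => y + t • v) v 0 := by
    simpa using ((hasDerivAt_id (0 : ℝ)).smul_const v).const_add y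
  have hrd : HasFDerivAt r (fderiv ℝ r y) y :=
    ((hr.contDiffAt (hV.mem_nhds hy)).differentiableAt (by simp)).hasFDerivAt
  exact hrd.comp_hasDerivAt_of_eq (0 : ℝ) hd (by simp)

/-! ### Smooth retractions -/

/-- `r` is a smooth retraction of the open set `V` onto `M ∩ V`, as far as points of `V` are
concerned: it maps `V` into `M` and fixes the points of `M` in `V`. -/
structure IsSmoothRetraction (M V : Set (EuclideanSpace ℝ (Fin n)))
    (r : EuclideanSpace ℝ (Fin n) → EuclideanSpace ℝ (Fin n)) : Prop where
  isOpen : IsOpen V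
  contDiffOn : ContDiffOn ℝ ∞ r V
  mem : ∀ y ∈ V, r y ∈ M
  eq_self : ∀ y ∈ M, y ∈ V → r y = y

namespace IsSmoothRetraction

variable {V : Set (EuclideanSpace ℝ (Fin n))}
  {r : EuclideanSpace ℝ (Fin n) → EuclideanSpace ℝ (Fin n)} {x y : EuclideanSpace ℝ (Fin n)}

theorem contDiffAt (h : IsSmoothRetraction M V r) (hy : y ∈ V) : ContDiffAt ℝ ∞ r y :=
  h.contDiffOn.contDiffAt (h.isOpen.mem_nhds hy)

theorem hasFDerivAt (h : IsSmoothRetraction M V r) (hy : y ∈ V) :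
    HasFDerivAt r (fderiv ℝ r y) y :=
  ((h.contDiffAt hy).differentiableAt (by simp)).hasFDerivAt

theorem hasFDerivAt_fderiv (h : IsSmoothRetraction M V r) (hy : y ∈ V) :
    HasFDerivAt (fderiv ℝ r) (fderiv ℝ (fderiv ℝ r) y) y :=
  (((h.contDiffAt hy).fderiv_right (m := 1) (by norm_cast)).differentiableAt
    (by simp)).hasFDerivAt

theorem fderiv_mem (h : IsSmoothRetraction M V r) (hyM : y ∈ M) (hy : y ∈ V)
    (v : EuclideanSpace ℝ (Fin n)) : fderiv ℝ r y v ∈ tangentSpace M y := by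
  simpa only [h.eq_self y hyM hy] using
    fderiv_mem_tangentSpace h.isOpen h.contDiffOn h.mem hy v

theorem fderiv_eq_self (h : IsSmoothRetraction M V r) (hyM : y ∈ M) (hy : y ∈ V)
    {v : EuclideanSpace ℝ (Fin n)} (hv : v ∈ tangentSpace M y) : fderiv ℝ r y v = v := by
  have h1 : HasFDerivWithinAt r (ContinuousLinearMap.id ℝ _) M y := by
    refine (hasFDerivWithinAt_id y M).congr_of_eventuallyEq ?_ (h.eq_self y hyM hy)
    filter_upwards [self_mem_nhdsWithin, mem_nhdsWithin_of_mem_nhds (h.isOpen.mem_nhds hy)]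
      with z hzM hz using h.eq_self z hzM hz
  rw [← fderivWithin_eq_of_mem_tangentSpace (h.hasFDerivAt hy).hasFDerivWithinAt hv,
    fderivWithin_eq_of_mem_tangentSpace h1 hv]
  rfl

theorem fderiv_eq_self_iff (h : IsSmoothRetraction M V r) (hyM : y ∈ M) (hy : y ∈ V)
    {v : EuclideanSpace ℝ (Fin n)} : fderiv ℝ r y v = v ↔ v ∈ tangentSpace M y :=
  ⟨fun hv => hv ▸ h.fderiv_mem hyM hy v, h.fderiv_eq_self hyM hy⟩

/-- The orthogonal projection `p` onto the range of an idempotent operator `T` satisfies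
`p (T + T† - 1) = T`. -/
theorem starProjection_mul (h : IsSmoothRetraction M V r) (hyM : y ∈ M) (hy : y ∈ V) :
    (tangentSpace M y).starProjection *
      (fderiv ℝ r y + ContinuousLinearMap.adjoint (fderiv ℝ r y) - 1) = fderiv ℝ r y := by
  ext1 v
  set T := fderiv ℝ r y
  have h1 : (tangentSpace M y).starProjection (T v) = T v :=
    Submodule.starProjection_eq_self_iff.2 (h.fderiv_mem hyM hy v)
  have h2 : (tangentSpace M y).starProjection (ContinuousLinearMap.adjoint T v - v) = 0 := by
    rw [Submodule.starProjection_apply_eq_zero_iff, Submodule.mem_orthogonal]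
    intro u hu
    rw [inner_sub_right, ContinuousLinearMap.adjoint_inner_right, h.fderiv_eq_self hyM hy hu,
      sub_self]
  calc (tangentSpace M y).starProjection (T v + ContinuousLinearMap.adjoint T v - v)
      = (tangentSpace M y).starProjection (T v + (ContinuousLinearMap.adjoint T v - v)) := by
        rw [add_sub_assoc]
    _ = T v := by rw [map_add, h1, h2, add_zero]

theorem isUnit_fderiv_add_adjoint (h : IsSmoothRetraction M V r) (hyM : y ∈ M) (hy : y ∈ V) :
    IsUnit (fderiv ℝ r y + ContinuousLinearMap.adjoint (fderiv ℝ r y) - 1) := by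
  set T := fderiv ℝ r y with hT
  have hTT : ∀ v, T (T v) = T v := fun v => h.fderiv_eq_self hyM hy (h.fderiv_mem hyM hy v)
  have hinj : Function.Injective (T + ContinuousLinearMap.adjoint T - 1 :
      EuclideanSpace ℝ (Fin n) →L[ℝ] EuclideanSpace ℝ (Fin n)) := by
    refine (injective_iff_map_eq_zero _).2 fun v hv => ?_
    have hv' : T v + ContinuousLinearMap.adjoint T v - v = 0 := hv
    have ha : ContinuousLinearMap.adjoint T v = v - T v := by
      rw [eq_sub_iff_add_eq, add_comm]; exact sub_eq_zero.1 hv'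
    -- `T† v = v - T v` lies in `ker T` and is orthogonal to it.
    have h0 : ContinuousLinearMap.adjoint T v = 0 := by
      rw [← inner_self_eq_zero (𝕜 := ℝ), ContinuousLinearMap.adjoint_inner_left, ha, map_sub,
        hTT, sub_self, inner_zero_right]
    have hTv : T v = v := (sub_eq_zero.1 (ha.symm.trans h0)).symm
    rw [← inner_self_eq_zero (𝕜 := ℝ)]
    nth_rewrite 2 [← hTv]
    rw [← ContinuousLinearMap.adjoint_inner_left, h0, inner_zero_left]
  have := (LinearMap.isUnit_iff_ker_eq_bot
    ((T + ContinuousLinearMap.adjoint T - 1 :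
      EuclideanSpace ℝ (Fin n) →L[ℝ] EuclideanSpace ℝ (Fin n)) :
      EuclideanSpace ℝ (Fin n) →ₗ[ℝ] EuclideanSpace ℝ (Fin n))).2 (LinearMap.ker_eq_bot.2 hinj)
  rw [ContinuousLinearMap.isUnit_iff_bijective]
  exact (Module.End.isUnit_iff _).1 this

/-- The tangential projection is differentiable along a submanifold. -/
theorem differentiableWithinAt_starProjection (h : IsSmoothRetraction M V r) (hxM : x ∈ M)
    (hx : x ∈ V) :
    DifferentiableWithinAt ℝ (fun y => (tangentSpace M y).starProjection) M x := by
  have hT : DifferentiableAt ℝ (fderiv ℝ r) x := (h.hasFDerivAt_fderiv hx).differentiableAt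
  have hadj : DifferentiableAt ℝ (fun y => ContinuousLinearMap.adjoint (fderiv ℝ r y)) x :=
    (ContinuousLinearMap.adjoint (𝕜 := ℝ) (E := EuclideanSpace ℝ (Fin n))
      (F := EuclideanSpace ℝ (Fin n))).toContinuousLinearEquiv.differentiableAt.comp x hT
  have hS : DifferentiableAt ℝ
      (fun y => fderiv ℝ r y + ContinuousLinearMap.adjoint (fderiv ℝ r y) - 1) x :=
    (hT.add hadj).sub_const 1
  have hinv := (differentiableAt_inverse (𝕜 := ℝ)
    (h.isUnit_fderiv_add_adjoint hxM hx)).comp x hS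
  have heq : ∀ y ∈ M, y ∈ V → (tangentSpace M y).starProjection = fderiv ℝ r y *
      Ring.inverse (fderiv ℝ r y + ContinuousLinearMap.adjoint (fderiv ℝ r y) - 1) := by
    intro y hyM hy
    conv_rhs => enter [1]; rw [← h.starProjection_mul hyM hy]
    rw [mul_assoc, Ring.mul_inverse_cancel _ (h.isUnit_fderiv_add_adjoint hyM hy), mul_one]
  refine (hT.mul hinv).differentiableWithinAt.congr_of_eventuallyEq ?_ (heq x hxM hx)
  filter_upwards [self_mem_nhdsWithin, mem_nhdsWithin_of_mem_nhds (h.isOpen.mem_nhds hx)]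
    with z hzM hz using heq z hzM hz

/-- The second fundamental form is the normal part of the Hessian of a local retraction. -/
theorem sffAlong_eq (h : IsSmoothRetraction M V r) (hxM : x ∈ M)
    (hx : x ∈ V) {v w ξ : EuclideanSpace ℝ (Fin n)} (hv : v ∈ tangentSpace M x)
    (hw : w ∈ tangentSpace M x) (hξ : ξ ∈ (tangentSpace M x)ᗮ) :
    sffAlong M x ξ v w = inner ℝ (fderiv ℝ (fderiv ℝ r) x v w) ξ := by
  obtain ⟨p', hp'⟩ := h.differentiableWithinAt_starProjection hxM hx
  have hpw : HasFDerivWithinAt (fun y => (tangentSpace M y).starProjection w) (p'.flip w) M x :=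
    (hp'.clm_apply (hasFDerivWithinAt_const w x M)).congr_fderiv (by ext; simp)
  have hT := h.hasFDerivAt_fderiv hx
  have hTw : HasFDerivWithinAt (fun y => fderiv ℝ r y w)
      ((fderiv ℝ (fderiv ℝ r) x).flip w) M x :=
    (hT.hasFDerivWithinAt.clm_apply (hasFDerivWithinAt_const w x M)).congr_fderiv (by ext; simp)
  -- Differentiate `p(y) (Dr(y) w) = Dr(y) w` along `M`.
  have hprod := hp'.clm_apply hTw
  have heq : HasFDerivWithinAt
      (fun y => (tangentSpace M y).starProjection (fderiv ℝ r y w))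
      ((fderiv ℝ (fderiv ℝ r) x).flip w) M x := by
    refine hTw.congr_of_eventuallyEq ?_
      (Submodule.starProjection_eq_self_iff.2 (h.fderiv_mem hxM hx w))
    filter_upwards [self_mem_nhdsWithin, mem_nhdsWithin_of_mem_nhds (h.isOpen.mem_nhds hx)]
      with z hzM hz using Submodule.starProjection_eq_self_iff.2 (h.fderiv_mem hzM hz w)
  have key := (fderivWithin_eq_of_mem_tangentSpace hprod hv).symm.trans
    (fderivWithin_eq_of_mem_tangentSpace heq hv)
  simp only [add_apply, ContinuousLinearMap.comp_apply,
    ContinuousLinearMap.flip_apply, h.fderiv_eq_self hxM hx hw] at key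
  rw [sffAlong, secondFundamentalForm, Submodule.inner_starProjection_left_eq_right,
    Submodule.starProjection_eq_self_iff.2 hξ, fderivWithin_eq_of_mem_tangentSpace hpw hv,
    ContinuousLinearMap.flip_apply, ← key, inner_add_left,
    Submodule.inner_right_of_mem_orthogonal (Submodule.starProjection_apply_mem _ _) hξ, zero_add]

end IsSmoothRetraction

/-- Around each of its points a submanifold is a smooth retract, with a tangent space of
dimension `k`: in a chart the retraction is a linear projection. -/
theorem IsSmoothSubmanifold.exists_isSmoothRetraction (hM : IsSmoothSubmanifold k M)
    {x : EuclideanSpace ℝ (Fin n)} (hx : x ∈ M) :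
    (∃ V r, x ∈ V ∧ IsSmoothRetraction M V r) ∧ Module.finrank ℝ (tangentSpace M x) = k := by
  obtain ⟨e, W, hxe, he, hes, hk, hMW⟩ := hM x hx
  set p := W.starProjection
  set V := e.source ∩ e ⁻¹' (p ⁻¹' e.target)
  have hfix : ∀ y ∈ M, y ∈ e.source → p (e y) = e y := fun y hyM hy =>
    Submodule.starProjection_eq_self_iff.2 ((hMW y hy).1 hyM)
  have hxV : x ∈ V := ⟨hxe, by
    rw [Set.mem_preimage, Set.mem_preimage, hfix x hx hxe]; exact e.map_source hxe⟩
  have hr : IsSmoothRetraction M V fun y => e.symm (p (e y)) := by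
    refine ⟨e.isOpen_inter_preimage (e.open_target.preimage p.continuous), ?_, ?_, ?_⟩
    · exact hes.comp (p.contDiff.comp_contDiffOn (he.mono Set.inter_subset_left))
        fun y hy => hy.2
    · intro y hy
      rw [hMW _ (e.map_target hy.2), e.right_inv hy.2]
      exact Submodule.starProjection_apply_mem _ _
    · intro y hyM hy
      rw [hfix y hyM hy.1, e.left_inv hy.1]
  refine ⟨⟨V, _, hxV, hr⟩, ?_⟩
  have hde : HasFDerivAt e (fderiv ℝ e x) x :=
    ((he.contDiffAt (e.open_source.mem_nhds hxe)).differentiableAt (by simp)).hasFDerivAt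
  have hex := e.map_source hxe
  have hds : HasFDerivAt e.symm (fderiv ℝ e.symm (e x)) (e x) :=
    ((hes.contDiffAt (e.open_target.mem_nhds hex)).differentiableAt (by simp)).hasFDerivAt
  have hds' : HasFDerivAt e.symm (fderiv ℝ e.symm (e x)) (p (e x)) := by
    rw [hfix x hx hxe]; exact hds
  have hBA : ∀ v, fderiv ℝ e.symm (e x) (fderiv ℝ e x v) = v := by
    intro v
    have h1 := hds.comp x hde
    have h2 : HasFDerivAt (e.symm ∘ e) (ContinuousLinearMap.id ℝ _) x :=
      (hasFDerivAt_id x).congr_of_eventuallyEq (e.eventually_left_inverse hxe)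
    exact DFunLike.congr_fun (h1.unique h2) v
  have hinj : Function.Injective (fderiv ℝ e x) := Function.LeftInverse.injective hBA
  have hrd : fderiv ℝ (fun y => e.symm (p (e y))) x =
      (fderiv ℝ e.symm (e x)).comp (p.comp (fderiv ℝ e x)) :=
    (hds'.comp x (p.hasFDerivAt.comp x hde)).fderiv
  let L := LinearEquiv.ofInjectiveEndo
    (fderiv ℝ e x : EuclideanSpace ℝ (Fin n) →ₗ[ℝ] EuclideanSpace ℝ (Fin n)) hinj
  have hL : ∀ v, L v = fderiv ℝ e x v := fun v => rfl
  have hBinj : Function.Injective (fderiv ℝ e.symm (e x)) := by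
    intro a b hab
    obtain ⟨a, rfl⟩ := L.surjective a
    obtain ⟨b, rfl⟩ := L.surjective b
    rw [hL, hL, hBA, hBA] at hab
    rw [hab]
  have hT : tangentSpace M x = W.map (L.symm : _ →ₗ[ℝ] EuclideanSpace ℝ (Fin n)) := by
    ext v
    rw [← hr.fderiv_eq_self_iff hx hxV, hrd]
    change fderiv ℝ e.symm (e x) (p (fderiv ℝ e x v)) = v ↔ _
    rw [Submodule.mem_map_equiv, LinearEquiv.symm_symm, hL, ← Submodule.starProjection_eq_self_iff]
    nth_rewrite 2 [← hBA v]
    exact hBinj.eq_iff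
  rw [hT, LinearEquiv.finrank_map_eq, hk]

/-! ### Principal directions of a submanifold -/

theorem IsSmoothSubmanifold.sffAlong_comm (hM : IsSmoothSubmanifold k M)
    {x v w ξ : EuclideanSpace ℝ (Fin n)} (hx : x ∈ M) (hv : v ∈ tangentSpace M x)
    (hw : w ∈ tangentSpace M x) (hξ : ξ ∈ (tangentSpace M x)ᗮ) :
    sffAlong M x ξ v w = sffAlong M x ξ w v := by
  obtain ⟨⟨V, r, hxV, hr⟩, -⟩ := hM.exists_isSmoothRetraction hx
  rw [hr.sffAlong_eq hx hxV hv hw hξ, hr.sffAlong_eq hx hxV hw hv hξ,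
    ((hr.contDiffAt hxV).isSymmSndFDerivAt
      (by rw [minSmoothness_of_isRCLikeNormedField]; norm_cast)).eq]

theorem sffAlong_smul_right (x ξ v w : EuclideanSpace ℝ (Fin n)) (c : ℝ) :
    sffAlong M x (c • ξ) v w = c * sffAlong M x ξ v w :=
  real_inner_smul_right _ _ _

theorem sffAlong_smul_left (x ξ v w : EuclideanSpace ℝ (Fin n)) (c : ℝ) :
    sffAlong M x ξ (c • v) w = c * sffAlong M x ξ v w := by
  simp [sffAlong, secondFundamentalForm, real_inner_smul_left]

/-- Spectral theorem for the second fundamental form in a normal direction. -/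
theorem IsSmoothSubmanifold.exists_orthonormalBasis_isPrincipalDirection
    (hM : IsSmoothSubmanifold k M) {x ξ : EuclideanSpace ℝ (Fin n)} (hx : x ∈ M)
    (hξ : ξ ∈ (tangentSpace M x)ᗮ) :
    ∃ (b : OrthonormalBasis (Fin k) ℝ (tangentSpace M x)) (β : Fin k → ℝ),
      ∀ i, IsPrincipalDirection M x ξ (b i) (β i) := by
  obtain ⟨⟨V, r, hxV, hr⟩, hk⟩ := hM.exists_isSmoothRetraction hx
  set D := fderiv ℝ (fderiv ℝ r) x
  set P := tangentSpace M x
  have hdual : ∀ v w : P, inner ℝ ((InnerProductSpace.toDual ℝ P).symm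
      ((innerSL ℝ ξ).comp ((D v).comp P.subtypeL))) w = inner ℝ ξ (D v w) :=
    fun v w => InnerProductSpace.toDual_symm_apply
  let S : P →ₗ[ℝ] P :=
    { toFun := fun v => (InnerProductSpace.toDual ℝ P).symm
        ((innerSL ℝ ξ).comp ((D v).comp P.subtypeL))
      map_add' := fun v w => ext_inner_right ℝ fun u => by
        rw [inner_add_left, hdual, hdual, hdual, Submodule.coe_add, map_add, add_apply,
          inner_add_right]
      map_smul' := fun c v => ext_inner_right ℝ fun u => by
        rw [RingHom.id_apply, real_inner_smul_left, hdual, hdual, Submodule.coe_smul, map_smul,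
          smul_apply, real_inner_smul_right] }
  have hS : ∀ v w : P, inner ℝ (S v) w = sffAlong M x ξ v w := fun v w => by
    rw [hr.sffAlong_eq hx hxV v.2 w.2 hξ]
    exact (hdual v w).trans (real_inner_comm _ _)
  have hsymm : S.IsSymmetric := fun v w => by
    rw [hS, real_inner_comm, hS, hM.sffAlong_comm hx v.2 w.2 hξ]
  refine ⟨hsymm.eigenvectorBasis hk, hsymm.eigenvalues hk, fun i => ⟨Subtype.prop _, ?_, ?_⟩⟩
  · intro h0
    have h1 := (hsymm.eigenvectorBasis hk).orthonormal.1 i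
    rw [Submodule.coe_eq_zero.1 h0, norm_zero] at h1
    exact zero_ne_one h1
  · intro w hw
    have h1 := hS (hsymm.eigenvectorBasis hk i) ⟨w, hw⟩
    rw [hsymm.apply_eigenvectorBasis, real_inner_smul_left] at h1
    exact h1.symm

/-! ### The tubular neighbourhood -/

/-- A nearest point of `M` sees the given point in a normal direction. -/
theorem sub_mem_orthogonal_of_infDist_eq {x y : EuclideanSpace ℝ (Fin n)}
    (h : Metric.infDist y M = dist y x) : y - x ∈ (tangentSpace M x)ᗮ := by
  suffices hle : tangentSpace M x ≤ (ℝ ∙ (y - x))ᗮ by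
    exact (Submodule.le_orthogonal_iff_le_orthogonal.1 hle) (Submodule.mem_span_singleton_self _)
  refine Submodule.span_le.2 ?_
  rintro v ⟨γ, ε, hε, -, hM, h0, hd⟩
  have hmin : IsLocalMin (fun t => ‖y - γ t‖ ^ 2) 0 := by
    filter_upwards [Ioo_mem_nhds (neg_lt_zero.2 hε) hε] with t ht
    have h1 := Metric.infDist_le_dist_of_mem (x := y) (hM t ht)
    rw [h, dist_eq_norm, dist_eq_norm] at h1
    rw [h0]
    gcongr
  have hder := hmin.hasDerivAt_eq_zero (hd.const_sub y).norm_sq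
  rw [h0, inner_neg_right] at hder
  rw [SetLike.mem_coe, Submodule.mem_orthogonal_singleton_iff_inner_right]
  linarith

/-- `π` is the nearest point projection of the open `r`-neighbourhood of `M`: it is smooth, its
fibres are the normal discs of radius `r`, and its displacement measures the distance to `M`. -/
structure IsTubularProjection (M : Set (EuclideanSpace ℝ (Fin n))) (r : ℝ)
    (π : EuclideanSpace ℝ (Fin n) → EuclideanSpace ℝ (Fin n)) : Prop where
  contDiffOn : ContDiffOn ℝ ∞ π {y | Metric.infDist y M < r}
  mem : ∀ y, Metric.infDist y M < r → π y ∈ M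
  sub_mem : ∀ y, Metric.infDist y M < r → y - π y ∈ (tangentSpace M (π y))ᗮ
  norm_sub : ∀ y, Metric.infDist y M < r → ‖y - π y‖ = Metric.infDist y M
  apply_add : ∀ x ∈ M, ∀ v ∈ (tangentSpace M x)ᗮ, ‖v‖ < r → π (x + v) = x

/-- If the normal exponential map is a diffeomorphism on the normal disc bundle of radius `r`,
its image is the `r`-neighbourhood and the first component of its inverse is the nearest point
projection. -/
theorem IsNormalDiffeoRadius.exists_isTubularProjection {r : ℝ} (h : IsNormalDiffeoRadius M r)
    (hMc : IsClosed M) (hne : M.Nonempty) : ∃ π, IsTubularProjection M r π := by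
  obtain ⟨-, G, hG, hinv⟩ := h
  have hnear : ∀ y, Metric.infDist y M < r → ∃ x, (x, y - x) ∈ normalDiscBundle M r ∧
      Metric.infDist y M = dist y x ∧ G y = (x, y - x) := by
    intro y hy
    obtain ⟨x, hx, hxy⟩ := hMc.exists_infDist_eq_dist hne y
    have hmem : (x, y - x) ∈ normalDiscBundle M r :=
      ⟨hx, sub_mem_orthogonal_of_infDist_eq hxy, by
        change ‖y - x‖ < r
        rwa [← dist_eq_norm, ← hxy]⟩
    refine ⟨x, hmem, hxy, ?_⟩
    simpa [normalExp] using hinv _ hmem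
  refine ⟨fun y => (G y).1, ?_, ?_, ?_, ?_, ?_⟩
  · refine contDiff_fst.comp_contDiffOn (hG.mono fun y hy => ?_)
    obtain ⟨x, hx, -, -⟩ := hnear y hy
    exact ⟨_, hx, by simp [normalExp]⟩
  · intro y hy
    obtain ⟨x, hx, -, hGy⟩ := hnear y hy
    rw [hGy]; exact hx.1
  · intro y hy
    obtain ⟨x, hx, -, hGy⟩ := hnear y hy
    rw [hGy]; exact hx.2.1
  · intro y hy
    obtain ⟨x, -, hxy, hGy⟩ := hnear y hy
    rw [hGy, hxy, dist_eq_norm]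
  · intro x hx v hv hvr
    have := hinv (x, v) ⟨hx, hv, hvr⟩
    exact congrArg Prod.fst this

namespace IsTubularProjection

variable {r : ℝ} {π : EuclideanSpace ℝ (Fin n) → EuclideanSpace ℝ (Fin n)}
  {x y u v w : EuclideanSpace ℝ (Fin n)}

theorem isOpen_tube (M : Set (EuclideanSpace ℝ (Fin n))) (r : ℝ) :
    IsOpen {y | Metric.infDist y M < r} :=
  isOpen_lt (Metric.continuous_infDist_pt M) continuous_const

theorem infDist_lt (_ : IsTubularProjection M r π) (hx : x ∈ M) (hur : ‖u‖ < r) :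
    Metric.infDist (x + u) M < r := by
  refine (Metric.infDist_le_dist_of_mem hx).trans_lt ?_
  rwa [dist_eq_norm, add_sub_cancel_left]

theorem infDist_add (h : IsTubularProjection M r π) (hx : x ∈ M)
    (hu : u ∈ (tangentSpace M x)ᗮ) (hur : ‖u‖ < r) : Metric.infDist (x + u) M = ‖u‖ := by
  rw [← h.norm_sub _ (h.infDist_lt hx hur), h.apply_add x hx u hu hur, add_sub_cancel_left]

theorem hasFDerivAt (h : IsTubularProjection M r π) (hy : Metric.infDist y M < r) :
    HasFDerivAt π (fderiv ℝ π y) y :=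
  ((h.contDiffOn.contDiffAt ((isOpen_tube M r).mem_nhds hy)).differentiableAt
    (by simp)).hasFDerivAt

theorem fderiv_mem (h : IsTubularProjection M r π) (hy : Metric.infDist y M < r)
    (v : EuclideanSpace ℝ (Fin n)) : fderiv ℝ π y v ∈ tangentSpace M (π y) :=
  fderiv_mem_tangentSpace (isOpen_tube M r) h.contDiffOn h.mem hy v

theorem hasFDerivAt_infDist_sq (h : IsTubularProjection M r π) (hy : Metric.infDist y M < r) :
    HasFDerivAt (fun z => Metric.infDist z M ^ 2) ((2 : ℝ) • innerSL ℝ (y - π y)) y := by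
  have h1 : HasFDerivAt (fun z => ‖z - π z‖ ^ 2) _ y :=
    ((hasFDerivAt_id y).fun_sub (h.hasFDerivAt hy)).norm_sq
  refine (h1.congr_fderiv ?_).congr_of_eventuallyEq ?_
  · ext v
    have h2 : inner ℝ (y - π y) (fderiv ℝ π y v) = 0 :=
      Submodule.inner_left_of_mem_orthogonal (h.fderiv_mem hy v) (h.sub_mem y hy)
    change 2 • inner ℝ (y - π y) (v - fderiv ℝ π y v) = (2 : ℝ) • inner ℝ (y - π y) v
    rw [inner_sub_right, h2, sub_zero, two_smul, two_smul]
  · filter_upwards [(isOpen_tube M r).mem_nhds hy] with z hz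
    rw [h.norm_sub z hz]

/-- The differential of the nearest point projection is symmetric, as `2 (1 - Dπ)` is the Hessian
of the squared distance. -/
theorem inner_fderiv_left (h : IsTubularProjection M r π) (hy : Metric.infDist y M < r)
    (v w : EuclideanSpace ℝ (Fin n)) :
    inner ℝ (fderiv ℝ π y v) w = inner ℝ v (fderiv ℝ π y w) := by
  have h2 : HasFDerivAt (fun z => (2 : ℝ) • innerSL ℝ (z - π z))
      ((2 : ℝ) • (innerSL ℝ (E := EuclideanSpace ℝ (Fin n))).comp
        (ContinuousLinearMap.id ℝ _ - fderiv ℝ π y)) y :=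
    ((innerSL ℝ (E := EuclideanSpace ℝ (Fin n))).hasFDerivAt.comp y
      ((hasFDerivAt_id y).fun_sub (h.hasFDerivAt hy))).fun_const_smul 2
  have h3 := second_derivative_symmetric_of_eventually
    (Filter.eventually_of_mem ((isOpen_tube M r).mem_nhds hy)
      fun z hz => h.hasFDerivAt_infDist_sq hz) h2 v w
  simp only [smul_apply, ContinuousLinearMap.comp_apply, sub_apply, innerSL_apply_apply,
    ContinuousLinearMap.id_apply, inner_sub_left, smul_eq_mul] at h3
  linarith [real_inner_comm w v, real_inner_comm (fderiv ℝ π y w) v]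

/-- The nearest point projection is constant along normal discs. -/
theorem fderiv_eq_zero (h : IsTubularProjection M r π) (hx : x ∈ M)
    (hu : u ∈ (tangentSpace M x)ᗮ) (hur : ‖u‖ < r) (hv : v ∈ (tangentSpace M x)ᗮ) :
    fderiv ℝ π (x + u) v = 0 := by
  have hl : HasDerivAt (fun t : ℝ => x + (u + t • v)) v 0 := by
    simpa using (((hasDerivAt_id (0 : ℝ)).smul_const v).const_add u).const_add x
  have h1 := (h.hasFDerivAt (h.infDist_lt hx hur)).comp_hasDerivAt_of_eq (0 : ℝ) hl (by simp)
  have h2 : HasDerivAt (π ∘ fun t : ℝ => x + (u + t • v)) 0 0 := by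
    refine (hasDerivAt_const (0 : ℝ) x).congr_of_eventuallyEq ?_
    have hcont : ContinuousAt (fun t : ℝ => ‖u + t • v‖) 0 := by fun_prop
    filter_upwards [hcont.eventually_lt_const (by simpa using hur)] with t ht
    exact h.apply_add x hx _ (add_mem hu (Submodule.smul_mem _ t hv)) ht
  exact h1.unique h2

/-- With `S` the shape operator of `M` in the direction `-u`, the differential of the nearest
point projection at `x + u` satisfies `(1 + S) Dπ = 1` on `T_x M`; this is the derivative of the
statement that displacements are normal. -/
theorem inner_fderiv_add_sffAlong (h : IsTubularProjection M r π) (hM : IsSmoothSubmanifold k M)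
    (hx : x ∈ M) (hu : u ∈ (tangentSpace M x)ᗮ) (hur : ‖u‖ < r)
    (v : EuclideanSpace ℝ (Fin n)) (hw : w ∈ tangentSpace M x) :
    inner ℝ (fderiv ℝ π (x + u) v) w + sffAlong M x (-u) (fderiv ℝ π (x + u) v) w =
      inner ℝ v w := by
  obtain ⟨⟨V, ρ, hxV, hρ⟩, -⟩ := hM.exists_isSmoothRetraction hx
  have hlt := h.infDist_lt hx hur
  have hπ := h.apply_add x hx u hu hur
  set a := fderiv ℝ π (x + u) v
  have hl : HasDerivAt (fun t : ℝ => x + u + t • v) v 0 := by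
    simpa using ((hasDerivAt_id (0 : ℝ)).smul_const v).const_add (x + u)
  have hc : HasDerivAt (fun t : ℝ => π (x + u + t • v)) a 0 :=
    (h.hasFDerivAt hlt).comp_hasDerivAt_of_eq (0 : ℝ) hl (by simp)
  have hev : ∀ᶠ t : ℝ in 𝓝 0, Metric.infDist (x + u + t • v) M < r :=
    hl.continuousAt.eventually_mem ((isOpen_tube M r).mem_nhds (by simpa using hlt))
  have hpw : DifferentiableWithinAt ℝ (fun y => (tangentSpace M y).starProjection w) M x :=
    (hρ.differentiableWithinAt_starProjection hx hxV).clm_apply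
      (differentiableWithinAt_const w)
  have hp : HasDerivAt (fun t : ℝ => (tangentSpace M (π (x + u + t • v))).starProjection w)
      (fderivWithin ℝ (fun y => (tangentSpace M y).starProjection w) M x a) 0 :=
    hpw.hasFDerivWithinAt.comp_hasDerivAt_of_eq (0 : ℝ) hc
      (hev.mono fun t ht => h.mem _ ht) (by simp [hπ])
  have hin := hp.inner ℝ (hl.fun_sub hc)
  have hzero : HasDerivAt (fun t : ℝ =>
      inner ℝ ((tangentSpace M (π (x + u + t • v))).starProjection w)
        (x + u + t • v - π (x + u + t • v))) 0 0 := by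
    refine (hasDerivAt_const (0 : ℝ) (0 : ℝ)).congr_of_eventuallyEq ?_
    filter_upwards [hev] with t ht
    exact Submodule.inner_right_of_mem_orthogonal (Submodule.starProjection_apply_mem _ _)
      (h.sub_mem _ ht)
  have key := hin.unique hzero
  simp only [zero_smul, add_zero, hπ, Submodule.starProjection_eq_self_iff.2 hw,
    add_sub_cancel_left, inner_sub_right] at key
  rw [sffAlong, secondFundamentalForm, Submodule.inner_starProjection_left_eq_right,
    Submodule.starProjection_eq_self_iff.2 (neg_mem hu), inner_neg_right,
    real_inner_comm w a, real_inner_comm w v]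
  linarith

end IsTubularProjection

/-! ### Level sets -/

/-- Regular level sets are hypersurfaces. If `ℓ = Dg(y)` and `ℓ ν = 1`, then
`z ↦ z + (g z - ℓ z) ν` has differential `1` at `y` and maps the zero set of `g` to `ker ℓ`. -/
theorem isSmoothSubmanifold_of_regular {N : Set (EuclideanSpace ℝ (Fin n))}
    (h : ∀ y ∈ N, ∃ (U : Set (EuclideanSpace ℝ (Fin n))) (g : EuclideanSpace ℝ (Fin n) → ℝ),
      IsOpen U ∧ y ∈ U ∧ ContDiffOn ℝ ∞ g U ∧ fderiv ℝ g y ≠ 0 ∧ ∀ z ∈ U, z ∈ N ↔ g z = 0) :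
    IsSmoothSubmanifold (n - 1) N := by
  intro y hy
  obtain ⟨U, g, hU, hyU, hg, hℓ, hN⟩ := h y hy
  set ℓ := fderiv ℝ g y with hℓdef
  obtain ⟨ν, hν⟩ : ∃ ν, ℓ ν = 1 := by
    obtain ⟨ν, hν⟩ : ∃ ν, ℓ ν ≠ 0 := by
      by_contra! hc
      exact hℓ (ContinuousLinearMap.ext hc)
    exact ⟨(ℓ ν)⁻¹ • ν, by rw [map_smul, smul_eq_mul, inv_mul_cancel₀ hν]⟩
  set F : EuclideanSpace ℝ (Fin n) → EuclideanSpace ℝ (Fin n) := fun z => z + (g z - ℓ z) • ν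
  have hFs : ContDiffOn ℝ ∞ F U :=
    contDiffOn_id.add ((hg.sub ℓ.contDiff.contDiffOn).smul contDiffOn_const)
  have hFd : ∀ z ∈ U, HasFDerivAt F
      (ContinuousLinearMap.id ℝ _ + (fderiv ℝ g z - ℓ).smulRight ν) z := by
    intro z hz
    have hgz : HasFDerivAt g (fderiv ℝ g z) z :=
      ((hg.contDiffAt (hU.mem_nhds hz)).differentiableAt (by simp)).hasFDerivAt
    exact (hasFDerivAt_id z).add ((hgz.sub ℓ.hasFDerivAt).smul_const ν)
  have hFy : HasFDerivAt F
      ((ContinuousLinearEquiv.refl ℝ (EuclideanSpace ℝ (Fin n)) :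
        EuclideanSpace ℝ (Fin n) →L[ℝ] EuclideanSpace ℝ (Fin n))) y :=
    (hFd y hyU).congr_fderiv (by ext; simp [hℓdef])
  have hFat := hFs.contDiffAt (hU.mem_nhds hyU)
  set φ := hFat.toOpenPartialHomeomorph F hFy (by simp)
  set V := U ∩ {z | fderiv ℝ g z ν ≠ 0}
  have hV : IsOpen V := by
    have hc : ContinuousOn (fun z => fderiv ℝ g z ν) U :=
      (hg.continuousOn_fderiv_of_isOpen hU (by simp)).clm_apply continuousOn_const
    exact hc.isOpen_inter_preimage hU isOpen_ne
  have hinj : ∀ z ∈ V, Function.Injective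
      (ContinuousLinearMap.id ℝ (EuclideanSpace ℝ (Fin n)) + (fderiv ℝ g z - ℓ).smulRight ν) := by
    intro z hz
    refine (injective_iff_map_eq_zero _).2 fun v hv => ?_
    have h1 : v + (fderiv ℝ g z v - ℓ v) • ν = 0 := hv
    -- Apply `Dg(z)` and `ℓ` to `v + (Dg(z) v - ℓ v) ν = 0`.
    have h2 : fderiv ℝ g z v + (fderiv ℝ g z v - ℓ v) * fderiv ℝ g z ν = 0 := by
      simpa using congrArg (fderiv ℝ g z) h1
    have h3 : ℓ v + (fderiv ℝ g z v - ℓ v) * 1 = 0 := by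
      simpa [hν] using congrArg ℓ h1
    have h4 : fderiv ℝ g z v = 0 := by linarith
    have h5 : ℓ v = 0 := by
      rw [h4, zero_add, zero_sub] at h2
      simpa using (mul_eq_zero.1 h2).resolve_right hz.2
    simpa [h4, h5] using h1
  refine ⟨φ.restrOpen V hV, LinearMap.ker (ℓ : EuclideanSpace ℝ (Fin n) →ₗ[ℝ] ℝ), ?_, ?_, ?_,
    ?_, ?_⟩
  · refine ⟨hFat.mem_toOpenPartialHomeomorph_source hFy (by simp), hyU, ?_⟩
    change ℓ ν ≠ 0
    rw [hν]; exact one_ne_zero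
  · exact hFs.mono fun z hz => hz.2.1
  · intro z hz
    have hz' := (φ.restrOpen V hV).map_target hz
    have hzV : (φ.restrOpen V hV).symm z ∈ V := hz'.2
    refine ContDiffAt.contDiffWithinAt ?_
    refine (φ.restrOpen V hV).contDiffAt_symm (f₀' :=
      (LinearEquiv.ofInjectiveEndo _ (hinj _ hzV)).toContinuousLinearEquiv) hz ?_
      (hFs.contDiffAt (hU.mem_nhds hzV.1))
    exact (hFd _ hzV.1).congr_fderiv (by ext; rfl)
  · have h1 := Module.Dual.finrank_ker_add_one_of_ne_zero
      (f := (ℓ : EuclideanSpace ℝ (Fin n) →ₗ[ℝ] ℝ))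
      (fun h0 => hℓ (ContinuousLinearMap.coe_injective h0))
    rw [finrank_euclideanSpace_fin] at h1
    omega
  · intro z hz
    rw [hN z hz.2.1, LinearMap.mem_ker]
    change g z = 0 ↔ ℓ (z + (g z - ℓ z) • ν) = 0
    rw [map_add, map_smul, hν, smul_eq_mul, mul_one, add_sub_cancel]

namespace IsTubularProjection

variable {r s : ℝ} {π : EuclideanSpace ℝ (Fin n) → EuclideanSpace ℝ (Fin n)}
  {y v w : EuclideanSpace ℝ (Fin n)}

theorem isSmoothSubmanifold_distLevel (h : IsTubularProjection M r π) (hs : 0 < s)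
    (hsr : s < r) : IsSmoothSubmanifold (n - 1) (distLevel M s) := by
  refine isSmoothSubmanifold_of_regular fun y (hy : Metric.infDist y M = s) =>
    ⟨{z | Metric.infDist z M < r}, fun z => Metric.infDist z M ^ 2 - s ^ 2, isOpen_tube M r,
      hy.trans_lt hsr, ?_, ?_, fun z _ => ?_⟩
  · refine ContDiffOn.sub (ContDiffOn.congr (f := fun z => ‖z - π z‖ ^ 2) ?_ ?_)
      contDiffOn_const
    · exact (contDiffOn_id.sub h.contDiffOn).norm_sq ℝ
    · intro z hz
      rw [h.norm_sub z hz]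
  · rw [((h.hasFDerivAt_infDist_sq (hy.trans_lt hsr)).sub_const _).fderiv]
    intro h0
    have h1 : (2 : ℝ) * inner ℝ (y - π y) (y - π y) = 0 := DFunLike.congr_fun h0 (y - π y)
    rw [real_inner_self_eq_norm_sq, h.norm_sub y (hy.trans_lt hsr), hy] at h1
    exact (by positivity : 2 * s ^ 2 ≠ 0) h1
  · rw [sub_eq_zero, pow_left_inj₀ Metric.infDist_nonneg hs.le two_ne_zero]
    rfl

theorem tangentSpace_distLevel (h : IsTubularProjection M r π) (hs : 0 < s) (hsr : s < r)
    (hy : y ∈ distLevel M s) : tangentSpace (distLevel M s) y = (ℝ ∙ (y - π y))ᗮ := by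
  have hlt : Metric.infDist y M < r := lt_of_eq_of_lt hy hsr
  refine Submodule.eq_of_le_of_finrank_eq (fun v hv => ?_) ?_
  · have h1 := fderiv_eq_zero_of_mem_tangentSpace
      (h.hasFDerivAt_infDist_sq hlt).hasFDerivWithinAt hy
      (fun z (hz : Metric.infDist z M = s) => congrArg (· ^ 2) hz) hv
    rw [Submodule.mem_orthogonal_singleton_iff_inner_right]
    have h2 : (2 : ℝ) * inner ℝ (y - π y) v = 0 := h1
    linarith
  · rw [((h.isSmoothSubmanifold_distLevel hs hsr).exists_isSmoothRetraction hy).2]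
    have h0 : y - π y ≠ 0 := by
      rw [← norm_ne_zero_iff, h.norm_sub y hlt]
      exact (hs.trans_eq (Eq.symm hy)).ne'
    have h1 := Submodule.finrank_add_finrank_orthogonal (ℝ ∙ (y - π y))
    rw [finrank_span_singleton h0, finrank_euclideanSpace_fin] at h1
    omega

/-- The level set has the normal field `z - π z`, whose differential `1 - Dπ` is its second
fundamental form. -/
theorem sffAlong_distLevel (h : IsTubularProjection M r π) (hs : 0 < s) (hsr : s < r)
    (hy : y ∈ distLevel M s) (hv : v ∈ tangentSpace (distLevel M s) y)
    (hw : w ∈ tangentSpace (distLevel M s) y) :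
    sffAlong (distLevel M s) y (-(y - π y)) v w = inner ℝ (v - fderiv ℝ π y v) w := by
  have hnorm : ∀ z ∈ distLevel M s, ‖z - π z‖ = s := fun z hz =>
    (h.norm_sub z (lt_of_eq_of_lt hz hsr)).trans hz
  have hproj : ∀ z ∈ distLevel M s, (tangentSpace (distLevel M s) z).starProjection w =
      w - (inner ℝ (z - π z) w / s ^ 2) • (z - π z) := by
    intro z hz
    simp only [h.tangentSpace_distLevel hs hsr hz, Submodule.starProjection_orthogonal_val,
      Submodule.starProjection_singleton, hnorm z hz]
    simp
  have hN : HasFDerivAt (fun z => z - π z) (ContinuousLinearMap.id ℝ _ - fderiv ℝ π y) y :=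
    (hasFDerivAt_id y).fun_sub (h.hasFDerivAt (lt_of_eq_of_lt hy hsr))
  have hin : HasFDerivAt (fun z => inner ℝ (z - π z) w / s ^ 2) _ y :=
    (hN.inner ℝ (hasFDerivAt_const w y)).mul_const (s ^ 2)⁻¹
  have hd := ((hin.smul hN).const_sub w).hasFDerivWithinAt.congr hproj (hproj y hy)
  have hyw : inner ℝ (y - π y) w = 0 := by
    rwa [h.tangentSpace_distLevel hs hsr hy,
      Submodule.mem_orthogonal_singleton_iff_inner_right] at hw
  have hperp : y - π y ∈ (tangentSpace (distLevel M s) y)ᗮ := by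
    rw [h.tangentSpace_distLevel hs hsr hy]
    exact Submodule.le_orthogonal_orthogonal _ (Submodule.mem_span_singleton_self _)
  rw [sffAlong, secondFundamentalForm, Submodule.inner_starProjection_left_eq_right,
    Submodule.starProjection_eq_self_iff.2 (neg_mem hperp),
    fderivWithin_eq_of_mem_tangentSpace hd hv]
  have hs2 : s ^ 2 ≠ 0 := by positivity
  have hself : inner ℝ (y - π y) (π y - y) = -s ^ 2 := by
    rw [← neg_sub y, inner_neg_right, real_inner_self_eq_norm_sq, hnorm y hy]
  simp only [neg_sub, neg_apply, smul_apply, hyw, zero_div, zero_smul, zero_add,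
    ContinuousLinearMap.smulRight_apply, ContinuousLinearMap.comp_apply,
    ContinuousLinearMap.prod_apply, fderivInnerCLM_apply, zero_apply,
    inner_zero_right, inner_neg_left, real_inner_smul_left, hself, sub_apply,
    ContinuousLinearMap.id_apply, smul_eq_mul]
  field_simp

end IsTubularProjection

/-! ### Principal directions of the level sets -/

theorem exists_isTubularProjection_of_lt {s : ℝ}
    (hs : ENNReal.ofReal s < normalInjectivityRadius M) (hMc : IsClosed M) (hne : M.Nonempty) :
    ∃ r π, s < r ∧ IsTubularProjection M r π := by
  simp only [normalInjectivityRadius, lt_iSup_iff] at hs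
  obtain ⟨r, hr, hsr⟩ := hs
  obtain ⟨π, hπ⟩ := hr.exists_isTubularProjection hMc hne
  refine ⟨r, π, ?_, hπ⟩
  rw [← ENNReal.ofReal_coe_nnreal] at hsr
  exact (ENNReal.ofReal_lt_ofReal_iff').1 hsr |>.1

theorem mem_orthogonal_span_singleton {E : Type*} [NormedAddCommGroup E] [InnerProductSpace ℝ E]
    {P : Submodule ℝ E} {ν v : E} (hν : ν ∈ Pᗮ) (hv : v ∈ P) : v ∈ (ℝ ∙ ν)ᗮ :=
  Submodule.mem_orthogonal_singleton_iff_inner_left.2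
    (Submodule.inner_right_of_mem_orthogonal hv hν)

theorem sup_orthogonal_sup_span {E : Type*} [NormedAddCommGroup E] [InnerProductSpace ℝ E]
    {P : Submodule ℝ E} [P.HasOrthogonalProjection] {ν : E} (hν : ν ∈ Pᗮ) :
    P ⊔ (P ⊔ ℝ ∙ ν)ᗮ = (ℝ ∙ ν)ᗮ := by
  have hP : P ≤ (ℝ ∙ ν)ᗮ := fun v hv => mem_orthogonal_span_singleton hν hv
  refine le_antisymm (sup_le hP (Submodule.orthogonal_le le_sup_right)) fun w hw => ?_
  rw [← add_sub_cancel (P.starProjection w) w, ← Submodule.inf_orthogonal]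
  exact Submodule.add_mem_sup (Submodule.starProjection_apply_mem _ _)
    ⟨Submodule.sub_starProjection_mem_orthogonal w,
      sub_mem hw (hP (Submodule.starProjection_apply_mem _ _))⟩

namespace IsTubularProjection

variable {r s t : ℝ} {π : EuclideanSpace ℝ (Fin n) → EuclideanSpace ℝ (Fin n)}
  {x ν v w : EuclideanSpace ℝ (Fin n)} {β κ : ℝ}

theorem infDist_add_smul (h : IsTubularProjection M r π) (hx : x ∈ M)
    (hν : ν ∈ (tangentSpace M x)ᗮ) (hν1 : ‖ν‖ = 1) (ht : |t| < r) :
    Metric.infDist (x + t • ν) M = |t| := by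
  have h1 : ‖t • ν‖ = |t| := by rw [norm_smul, hν1, mul_one, Real.norm_eq_abs]
  rw [h.infDist_add hx (Submodule.smul_mem _ t hν) (h1.trans_lt ht), h1]

theorem add_smul_mem_distLevel (h : IsTubularProjection M r π) (hx : x ∈ M)
    (hν : ν ∈ (tangentSpace M x)ᗮ) (hν1 : ‖ν‖ = 1) (hs : 0 < s) (hsr : s < r) :
    x + s • ν ∈ distLevel M s := by
  have h1 := h.infDist_add_smul hx hν hν1 (t := s) (by rwa [abs_of_pos hs])
  rwa [abs_of_pos hs] at h1

theorem apply_add_smul (h : IsTubularProjection M r π) (hx : x ∈ M)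
    (hν : ν ∈ (tangentSpace M x)ᗮ) (hν1 : ‖ν‖ = 1) (ht : |t| < r) : π (x + t • ν) = x :=
  h.apply_add x hx _ (Submodule.smul_mem _ t hν)
    (by rwa [norm_smul, hν1, mul_one, Real.norm_eq_abs])

theorem tangentSpace_distLevel_add_smul (h : IsTubularProjection M r π) (hx : x ∈ M)
    (hν : ν ∈ (tangentSpace M x)ᗮ) (hν1 : ‖ν‖ = 1) (hs : 0 < s) (hsr : s < r) :
    tangentSpace (distLevel M s) (x + s • ν) = (ℝ ∙ ν)ᗮ := by
  rw [h.tangentSpace_distLevel hs hsr (h.add_smul_mem_distLevel hx hν hν1 hs hsr),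
    h.apply_add_smul hx hν hν1 (by rwa [abs_of_pos hs]), add_sub_cancel_left,
    Submodule.span_singleton_smul_eq hs.ne'.isUnit]

theorem fderiv_mem_of_add_smul (h : IsTubularProjection M r π) (hx : x ∈ M)
    (hν : ν ∈ (tangentSpace M x)ᗮ) (hν1 : ‖ν‖ = 1) (ht : |t| < r)
    (v : EuclideanSpace ℝ (Fin n)) : fderiv ℝ π (x + t • ν) v ∈ tangentSpace M x := by
  have h1 := h.fderiv_mem (y := x + t • ν) (by rwa [h.infDist_add_smul hx hν hν1 ht]) v
  rwa [h.apply_add_smul hx hν hν1 ht] at h1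

theorem sffAlong_distLevel_add_smul (h : IsTubularProjection M r π) (hx : x ∈ M)
    (hν : ν ∈ (tangentSpace M x)ᗮ) (hν1 : ‖ν‖ = 1) (hs : 0 < s) (hsr : s < r)
    (hv : v ∈ (ℝ ∙ ν)ᗮ) (hw : w ∈ (ℝ ∙ ν)ᗮ) :
    s * sffAlong (distLevel M s) (x + s • ν) (-ν) v w =
      inner ℝ (v - fderiv ℝ π (x + s • ν) v) w := by
  have hT := h.tangentSpace_distLevel_add_smul hx hν hν1 hs hsr
  rw [← h.sffAlong_distLevel hs hsr (h.add_smul_mem_distLevel hx hν hν1 hs hsr)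
    (hT.symm ▸ hv) (hT.symm ▸ hw), h.apply_add_smul hx hν hν1 (by rwa [abs_of_pos hs]),
    add_sub_cancel_left, ← smul_neg, sffAlong_smul_right]

theorem inner_fderiv_add_mul_sffAlong (h : IsTubularProjection M r π)
    (hM : IsSmoothSubmanifold k M) (hx : x ∈ M) (hν : ν ∈ (tangentSpace M x)ᗮ) (hν1 : ‖ν‖ = 1)
    (ht : |t| < r) (v : EuclideanSpace ℝ (Fin n)) (hw : w ∈ tangentSpace M x) :
    inner ℝ (fderiv ℝ π (x + t • ν) v) w +
      t * sffAlong M x (-ν) (fderiv ℝ π (x + t • ν) v) w = inner ℝ v w := by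
  rw [← sffAlong_smul_right, smul_neg]
  exact h.inner_fderiv_add_sffAlong hM hx (Submodule.smul_mem _ t hν)
    (by rwa [norm_smul, hν1, mul_one, Real.norm_eq_abs]) v hw

/-- Principal directions of `M` are eigenvectors of `Dπ` at `x + tν`, with eigenvalue
`1 / (1 + tβ)`. -/
theorem smul_fderiv_eq (h : IsTubularProjection M r π) (hM : IsSmoothSubmanifold k M)
    (hx : x ∈ M) (hν : ν ∈ (tangentSpace M x)ᗮ) (hν1 : ‖ν‖ = 1) (ht : |t| < r)
    (hv : IsPrincipalDirection M x (-ν) v β) :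
    (1 + t * β) • fderiv ℝ π (x + t • ν) v = v := by
  refine ext_inner_left ℝ fun u => ?_
  have hmem := h.fderiv_mem_of_add_smul hx hν hν1 ht u
  have h1 := h.inner_fderiv_add_mul_sffAlong hM hx hν hν1 ht u hv.1
  rw [hM.sffAlong_comm hx hmem hv.1 (neg_mem hν), hv.2.2 _ hmem,
    real_inner_comm (fderiv ℝ π (x + t • ν) u) v,
    h.inner_fderiv_left (by rwa [h.infDist_add_smul hx hν hν1 ht])] at h1
  rw [real_inner_smul_right, ← h1]
  ring

/-- The principal curvatures of `M` are at most `1 / r`: otherwise there would be a focal point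
at distance less than `r`. -/
theorem abs_mul_le_one (h : IsTubularProjection M r π) (hM : IsSmoothSubmanifold k M)
    (hx : x ∈ M) (hν : ν ∈ (tangentSpace M x)ᗮ) (hν1 : ‖ν‖ = 1)
    (hv : IsPrincipalDirection M x (-ν) v β) : |β| * r ≤ 1 := by
  by_contra! hlt
  have hβ : β ≠ 0 := by
    rintro rfl
    rw [abs_zero, zero_mul] at hlt
    linarith
  have ht : |-β⁻¹| < r := by
    rw [abs_neg, abs_inv, inv_lt_iff_one_lt_mul₀ (abs_pos.2 hβ), mul_comm]
    exact hlt
  have h1 := h.smul_fderiv_eq hM hx hν hν1 ht hv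
  rw [neg_mul, inv_mul_cancel₀ hβ, add_neg_cancel, zero_smul] at h1
  exact hv.2.1 h1.symm

theorem one_add_mul_pos (h : IsTubularProjection M r π) (hM : IsSmoothSubmanifold k M)
    (hx : x ∈ M) (hν : ν ∈ (tangentSpace M x)ᗮ) (hν1 : ‖ν‖ = 1) (hs : 0 < s) (hsr : s < r)
    (hv : IsPrincipalDirection M x (-ν) v β) : 0 < 1 + s * β := by
  have h1 := h.abs_mul_le_one hM hx hν hν1 hv
  rcases le_or_gt 0 β with hβ | hβ
  · positivity
  · rw [abs_of_neg hβ] at h1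
    nlinarith

/-- For a principal direction `v` of `M`, `(1 - Dπ) v = s (β / (1 + sβ)) v` at `x + sν`. -/
theorem sub_fderiv_eq (h : IsTubularProjection M r π) (hM : IsSmoothSubmanifold k M)
    (hx : x ∈ M) (hν : ν ∈ (tangentSpace M x)ᗮ) (hν1 : ‖ν‖ = 1) (hs : 0 < s) (hsr : s < r)
    (hv : IsPrincipalDirection M x (-ν) v β) :
    v - fderiv ℝ π (x + s • ν) v = (s * (β / (1 + s * β))) • v := by
  have hpos := h.one_add_mul_pos hM hx hν hν1 hs hsr hv
  have h1 := h.smul_fderiv_eq hM hx hν hν1 (by rwa [abs_of_pos hs]) hv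
  have h2 : fderiv ℝ π (x + s • ν) v = (1 + s * β)⁻¹ • v := by
    rw [eq_inv_smul_iff₀ hpos.ne', h1]
  rw [h2]
  nth_rewrite 1 [← one_smul ℝ v]
  rw [← sub_smul]
  congr 1
  field_simp
  ring

theorem isPrincipalDirection_distLevel (h : IsTubularProjection M r π)
    (hM : IsSmoothSubmanifold k M)
    (hx : x ∈ M) (hν : ν ∈ (tangentSpace M x)ᗮ) (hν1 : ‖ν‖ = 1) (hs : 0 < s) (hsr : s < r)
    (hv : IsPrincipalDirection M x (-ν) v β) :
    IsPrincipalDirection (distLevel M s) (x + s • ν) (-ν) v (β / (1 + s * β)) := by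
  have hT := h.tangentSpace_distLevel_add_smul hx hν hν1 hs hsr
  have hvν := mem_orthogonal_span_singleton hν hv.1
  refine ⟨hT.symm ▸ hvν, hv.2.1, fun w hw => ?_⟩
  rw [hT] at hw
  have h1 := h.sffAlong_distLevel_add_smul hx hν hν1 hs hsr hvν hw
  rw [h.sub_fderiv_eq hM hx hν hν1 hs hsr hv, real_inner_smul_left, mul_assoc] at h1
  exact mul_left_cancel₀ hs.ne' h1

theorem sffAlong_distLevel_of_normal (h : IsTubularProjection M r π)
    (hx : x ∈ M) (hν : ν ∈ (tangentSpace M x)ᗮ) (hν1 : ‖ν‖ = 1) (hs : 0 < s) (hsr : s < r)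
    (hv : v ∈ (tangentSpace M x)ᗮ) (hvν : v ∈ (ℝ ∙ ν)ᗮ) (hw : w ∈ (ℝ ∙ ν)ᗮ) :
    sffAlong (distLevel M s) (x + s • ν) (-ν) v w = 1 / s * inner ℝ v w := by
  have h1 := h.sffAlong_distLevel_add_smul hx hν hν1 hs hsr hvν hw
  rw [h.fderiv_eq_zero hx (Submodule.smul_mem _ s hν)
    (by rwa [norm_smul, hν1, mul_one, Real.norm_eq_abs, abs_of_pos hs]) hv, sub_zero] at h1
  rw [← h1]
  field_simp

/-- A principal direction of `M^s` is an eigenvector of `Dπ`. The kernel of `Dπ` is the normal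
space of `M`; eigenvectors for nonzero eigenvalues are tangent and principal for `M`. -/
theorem mem_orthogonal_or_isPrincipalDirection (h : IsTubularProjection M r π)
    (hM : IsSmoothSubmanifold k M)
    (hx : x ∈ M) (hν : ν ∈ (tangentSpace M x)ᗮ) (hν1 : ‖ν‖ = 1) (hs : 0 < s) (hsr : s < r)
    (hw : IsPrincipalDirection (distLevel M s) (x + s • ν) (-ν) w κ) :
    w ∈ (tangentSpace M x ⊔ ℝ ∙ ν)ᗮ ∨ ∃ β, IsPrincipalDirection M x (-ν) w β := by
  have hsr' : |s| < r := by rwa [abs_of_pos hs]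
  have hT := h.tangentSpace_distLevel_add_smul hx hν hν1 hs hsr
  obtain ⟨hwν, hw0, hwκ⟩ := hw
  rw [hT] at hwν hwκ
  have hmem := h.fderiv_mem_of_add_smul hx hν hν1 hsr' w
  set a := fderiv ℝ π (x + s • ν) w with ha
  have heq : w - a - (s * κ) • w = 0 := by
    have hin : w - a - (s * κ) • w ∈ (ℝ ∙ ν)ᗮ :=
      _root_.sub_mem (_root_.sub_mem hwν (mem_orthogonal_span_singleton hν hmem))
        (Submodule.smul_mem _ _ hwν)
    rw [← inner_self_eq_zero (𝕜 := ℝ), inner_sub_left,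
      ← h.sffAlong_distLevel_add_smul hx hν hν1 hs hsr hwν hin, hwκ _ hin, real_inner_smul_left,
      mul_assoc, sub_self]
  have haw : a = (1 - s * κ) • w := by
    rw [sub_smul, one_smul, ← sub_eq_zero, ← neg_eq_zero, ← heq]
    abel
  have hkey := fun u (hu : u ∈ tangentSpace M x) =>
    h.inner_fderiv_add_mul_sffAlong hM hx hν hν1 hsr' w hu
  simp only [← ha, haw, real_inner_smul_left, sffAlong_smul_left] at hkey
  rcases eq_or_ne (1 - s * κ) 0 with h0 | h0
  · left
    rw [← Submodule.inf_orthogonal]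
    refine ⟨(Submodule.mem_orthogonal' _ _).2 fun u hu => ?_, hwν⟩
    rw [← hkey u hu, h0]
    ring
  · right
    refine ⟨κ / (1 - s * κ), ?_, hw0, fun u hu => ?_⟩
    · rw [haw] at hmem
      exact (Submodule.smul_mem_iff _ h0).1 hmem
    · have h1 := hkey u hu
      have h2 : s * ((1 - s * κ) * sffAlong M x (-ν) w u) = s * (κ * inner ℝ w u) := by linarith
      rw [div_mul_eq_mul_div, eq_div_iff h0, ← mul_left_cancel₀ hs.ne' h2, mul_comm]

/-- The second fundamental form of `M^s` on `T_x M`, diagonalised by principal directions. -/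
theorem sffAlong_distLevel_eq_sum (h : IsTubularProjection M r π)
    (hM : IsSmoothSubmanifold k M) {b : OrthonormalBasis (Fin k) ℝ (tangentSpace M x)}
    {β : Fin k → ℝ} (hb : ∀ i, IsPrincipalDirection M x (-ν) (b i) (β i))
    (hx : x ∈ M) (hν : ν ∈ (tangentSpace M x)ᗮ) (hν1 : ‖ν‖ = 1) (hs : 0 < s) (hsr : s < r)
    (v w : tangentSpace M x) :
    sffAlong (distLevel M s) (x + s • ν) (-ν) v w =
      ∑ i, β i / (1 + s * β i) * (inner ℝ (b i) v * inner ℝ (b i) w) := by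
  have hvsum : (v : EuclideanSpace ℝ (Fin n)) =
      ∑ i, inner ℝ (b i) v • (b i : EuclideanSpace ℝ (Fin n)) := by
    conv_lhs => rw [← b.sum_repr' v]
    simp
  have h1 := h.sffAlong_distLevel_add_smul hx hν hν1 hs hsr (mem_orthogonal_span_singleton hν v.2)
    (mem_orthogonal_span_singleton hν w.2)
  refine mul_left_cancel₀ hs.ne' (h1.trans ?_)
  rw [hvsum, map_sum, ← Finset.sum_sub_distrib, sum_inner, Finset.mul_sum]
  refine Finset.sum_congr rfl fun i _ => ?_
  rw [map_smul, ← smul_sub, h.sub_fderiv_eq hM hx hν hν1 hs hsr (hb i), real_inner_smul_left,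
    real_inner_smul_left, Submodule.coe_inner (tangentSpace M x) (b i) w]
  ring

theorem sffAlong_distLevel_lt (h : IsTubularProjection M r π) (hM : IsSmoothSubmanifold k M)
    (hx : x ∈ M) (hν : ν ∈ (tangentSpace M x)ᗮ) (hν1 : ‖ν‖ = 1) (hs : 0 < s) (hsr : s < r)
    (hv : v ∈ tangentSpace M x) (hv1 : ‖v‖ = 1) :
    sffAlong (distLevel M s) (x + s • ν) (-ν) v v < 1 / s := by
  obtain ⟨b, β, hb⟩ := hM.exists_orthonormalBasis_isPrincipalDirection hx (neg_mem hν)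
  have hsum := b.sum_sq_norm_inner_right ⟨v, hv⟩
  rw [Submodule.coe_norm, hv1, one_pow] at hsum
  simp only [Real.norm_eq_abs, sq_abs] at hsum
  have hlt : ∀ i, β i / (1 + s * β i) < 1 / s := fun i => by
    rw [div_lt_div_iff₀ (h.one_add_mul_pos hM hx hν hν1 hs hsr (hb i)) hs]
    linarith
  obtain ⟨i, -, hi⟩ := Finset.exists_ne_zero_of_sum_ne_zero (hsum.trans_ne one_ne_zero)
  have hs1 : 1 / s = ∑ i, 1 / s * inner ℝ (b i) ⟨v, hv⟩ ^ 2 := by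
    rw [← Finset.mul_sum, hsum, mul_one]
  rw [h.sffAlong_distLevel_eq_sum hM hb hx hν hν1 hs hsr ⟨v, hv⟩ ⟨v, hv⟩, hs1]
  refine Finset.sum_lt_sum (fun j _ => ?_) ⟨i, Finset.mem_univ i, ?_⟩
  · rw [← pow_two]
    exact mul_le_mul_of_nonneg_right (hlt j).le (sq_nonneg _)
  · rw [← pow_two]
    exact mul_lt_mul_of_pos_right (hlt i) (lt_of_le_of_ne (sq_nonneg _) hi.symm)

/-- The principal curvatures `β / (1 + sβ)` are uniformly bounded as `|β| ≤ 1 / r`. -/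
theorem abs_sffAlong_distLevel_le {δ : ℝ} (h : IsTubularProjection M r π)
    (hM : IsSmoothSubmanifold k M)
    (hx : x ∈ M) (hν : ν ∈ (tangentSpace M x)ᗮ) (hν1 : ‖ν‖ = 1) (hs : 0 < s) (hsδ : s ≤ δ)
    (hδr : δ < r) (hv : v ∈ tangentSpace M x) (hw : w ∈ tangentSpace M x) :
    |sffAlong (distLevel M s) (x + s • ν) (-ν) v w| ≤ (r - δ)⁻¹ * ‖v‖ * ‖w‖ := by
  obtain ⟨b, β, hb⟩ := hM.exists_orthonormalBasis_isPrincipalDirection hx (neg_mem hν)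
  have hsr := hsδ.trans_lt hδr
  have hC : 0 < r - δ := sub_pos.2 hδr
  have hbound : ∀ i, |β i / (1 + s * β i)| ≤ (r - δ)⁻¹ := fun i => by
    have hpos := h.one_add_mul_pos hM hx hν hν1 hs hsr (hb i)
    have h1 := h.abs_mul_le_one hM hx hν hν1 (hb i)
    have h2 := mul_le_mul_of_nonneg_left hsδ (abs_nonneg (β i))
    have h3 := mul_le_mul_of_nonneg_left (neg_abs_le (β i)) hs.le
    rw [abs_div, abs_of_pos hpos, inv_eq_one_div, div_le_div_iff₀ hpos hC]
    linarith
  rw [h.sffAlong_distLevel_eq_sum hM hb hx hν hν1 hs hsr ⟨v, hv⟩ ⟨w, hw⟩]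
  calc |∑ i, β i / (1 + s * β i) * (inner ℝ (b i) ⟨v, hv⟩ * inner ℝ (b i) ⟨w, hw⟩)|
      ≤ ∑ i, (r - δ)⁻¹ * (‖inner ℝ (b i) ⟨v, hv⟩‖ * ‖inner ℝ (b i) ⟨w, hw⟩‖) := by
        refine (Finset.abs_sum_le_sum_abs _ _).trans (Finset.sum_le_sum fun i _ => ?_)
        rw [abs_mul, abs_mul]
        exact mul_le_mul_of_nonneg_right (hbound i) (by positivity)
    _ ≤ (r - δ)⁻¹ * (‖v‖ * ‖w‖) := by
        rw [← Finset.mul_sum]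
        refine mul_le_mul_of_nonneg_left ?_ (inv_nonneg.2 hC.le)
        refine (Real.sum_mul_le_sqrt_mul_sqrt _ _ _).trans_eq ?_
        rw [b.sum_sq_norm_inner_right, b.sum_sq_norm_inner_right,
          Real.sqrt_sq (norm_nonneg _), Real.sqrt_sq (norm_nonneg _)]
        rfl
    _ = (r - δ)⁻¹ * ‖v‖ * ‖w‖ := (mul_assoc _ _ _).symm

theorem isInteriorUnitNormal_iff (h : IsTubularProjection M r π)
    (hx : x ∈ M) (hν : ν ∈ (tangentSpace M x)ᗮ) (hν1 : ‖ν‖ = 1) (hs : 0 < s) (hsr : s < r)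
    (η : EuclideanSpace ℝ (Fin n)) :
    IsInteriorUnitNormal M s (x + s • ν) η ↔ η = -ν := by
  have hT := h.tangentSpace_distLevel_add_smul hx hν hν1 hs hsr
  have hpt : ∀ t : ℝ, x + s • ν + t • ν = x + (s + t) • ν := fun t => by
    rw [add_smul, add_assoc]
  rw [IsInteriorUnitNormal, hT, Submodule.orthogonal_orthogonal]
  constructor
  · rintro ⟨hη1, hη, hev⟩
    obtain ⟨c, rfl⟩ := Submodule.mem_span_singleton.1 hη
    rw [norm_smul, hν1, mul_one, Real.norm_eq_abs] at hη1
    rcases eq_or_eq_neg_of_abs_eq hη1 with rfl | rfl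
    · exfalso
      obtain ⟨t, ht1, ht0, ht2⟩ :=
        (hev.and (Ioo_mem_nhdsGT (sub_pos.2 hsr))).exists
      rw [one_smul, hpt, h.infDist_add_smul hx hν hν1
        (by rw [abs_of_pos (by linarith)]; linarith), abs_of_pos (by linarith)] at ht1
      linarith
    · rw [neg_smul, one_smul]
  · rintro rfl
    refine ⟨by rw [norm_neg, hν1], neg_mem (Submodule.mem_span_singleton_self ν), ?_⟩
    filter_upwards [Ioo_mem_nhdsGT hs] with t ht
    rw [smul_neg, ← neg_smul, hpt, h.infDist_add_smul hx hν hν1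
      (by rw [abs_of_pos (by linarith [ht.2])]; linarith [ht.1]), abs_of_pos (by linarith [ht.2])]
    linarith [ht.1]

end IsTubularProjection

end Tub

end

theorem lemma3p3 (n k : ℕ) (M : Set (EuclideanSpace ℝ (Fin n)))
    (hM : Tub.IsSmoothSubmanifold k M) (hMc : IsClosed M) :
    -- the level sets are smooth hypersurfaces
    (∀ s : ℝ, 0 < s → ENNReal.ofReal s < Tub.normalInjectivityRadius M →
      Tub.IsSmoothSubmanifold (n - 1) (Tub.distLevel M s)) ∧
    (∀ x ∈ M, ∀ ν ∈ (Tub.tangentSpace M x)ᗮ, ‖ν‖ = 1 →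
      ∀ P Q : Submodule ℝ (EuclideanSpace ℝ (Fin n)),
      P = Tub.tangentSpace M x → Q = (P ⊔ Submodule.span ℝ {ν})ᗮ →
      -- there is an orthonormal basis of `P` of principal directions of `A^{-ν}`
      (∃ (b : OrthonormalBasis (Fin k) ℝ P) (β : Fin k → ℝ),
        ∀ i, Tub.IsPrincipalDirection M x (-ν) (b i) (β i)) ∧
      (∀ s : ℝ, 0 < s → ENNReal.ofReal s < Tub.normalInjectivityRadius M →
        -- `x + sν` lies on `M^s`, whose tangent space there is `ν^⊥ = P ⊕ Q`,
        -- and whose interior unit normal there is `-ν`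
        x + s • ν ∈ Tub.distLevel M s ∧
        Tub.tangentSpace (Tub.distLevel M s) (x + s • ν) = P ⊔ Q ∧
        (∀ η, Tub.IsInteriorUnitNormal M s (x + s • ν) η ↔ η = -ν) ∧
        -- the principal directions split according to `P` and `Q`
        (∀ w κ, Tub.IsPrincipalDirection (Tub.distLevel M s) (x + s • ν) (-ν) w κ →
          w ∈ P ∨ w ∈ Q) ∧
        -- the principal directions are independent of `s`
        (∀ s' : ℝ, 0 < s' → ENNReal.ofReal s' < Tub.normalInjectivityRadius M → ∀ w,
          (∃ κ, Tub.IsPrincipalDirection (Tub.distLevel M s) (x + s • ν) (-ν) w κ) →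
          ∃ κ, Tub.IsPrincipalDirection (Tub.distLevel M s') (x + s' • ν) (-ν) w κ) ∧
        -- on `Q` the second fundamental form is `(1/s) Id`
        (∀ q ∈ Q, ∀ w ∈ P ⊔ Q,
          Tub.sffAlong (Tub.distLevel M s) (x + s • ν) (-ν) q w = 1 / s * inner ℝ q w) ∧
        -- principal directions of `A^{-ν}` in `P` and their principal curvatures
        (∀ v β, Tub.IsPrincipalDirection M x (-ν) v β →
          0 < 1 + s * β ∧
          Tub.IsPrincipalDirection (Tub.distLevel M s) (x + s • ν) (-ν) v (β / (1 + s * β)) ∧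
          (‖v‖ = 1 →
            Tub.sffAlong (Tub.distLevel M s) (x + s • ν) (-ν) v v = β / (1 + s * β))) ∧
        -- the strict upper bound on `P`
        (∀ v ∈ P, ‖v‖ = 1 →
          Tub.sffAlong (Tub.distLevel M s) (x + s • ν) (-ν) v v < 1 / s))) ∧
    -- `A^s` restricted to `P` is bounded on every smaller tubular neighborhood
    (∀ δ : ℝ, ENNReal.ofReal δ < Tub.normalInjectivityRadius M → ∃ C : ℝ,
      ∀ s : ℝ, 0 < s → s ≤ δ → ∀ x ∈ M, ∀ ν ∈ (Tub.tangentSpace M x)ᗮ, ‖ν‖ = 1 →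
        ∀ v ∈ Tub.tangentSpace M x, ∀ w ∈ Tub.tangentSpace M x,
          |Tub.sffAlong (Tub.distLevel M s) (x + s • ν) (-ν) v w| ≤ C * ‖v‖ * ‖w‖) := by
  have hpos : ∀ s : ℝ, 0 < s → (Tub.distLevel M s).Nonempty → M.Nonempty := by
    rintro s hs ⟨y, hy⟩
    by_contra hne
    rw [Set.not_nonempty_iff_eq_empty] at hne
    have h0 : Metric.infDist y M = s := hy
    rw [hne, Metric.infDist_empty] at h0
    exact hs.ne h0
  refine ⟨fun s hs hsρ => ?_, fun x hx ν hν hν1 P Q hP hQ => ⟨?_, fun s hs hsρ => ?_⟩,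
    fun δ hδ => ?_⟩
  · rcases (Tub.distLevel M s).eq_empty_or_nonempty with he | hne
    · intro y hy
      rw [he] at hy
      exact hy.elim
    · obtain ⟨r, π, hsr, h⟩ := Tub.exists_isTubularProjection_of_lt hsρ hMc (hpos s hs hne)
      exact h.isSmoothSubmanifold_distLevel hs hsr
  · subst hP
    exact hM.exists_orthonormalBasis_isPrincipalDirection hx (neg_mem hν)
  · subst hP
    subst hQ
    obtain ⟨r, π, hsr, h⟩ := Tub.exists_isTubularProjection_of_lt hsρ hMc ⟨x, hx⟩
    have hsup := Tub.sup_orthogonal_sup_span hν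
    have hnormal : ∀ q ∈ (Tub.tangentSpace M x ⊔ Submodule.span ℝ {ν})ᗮ,
        q ∈ (Tub.tangentSpace M x)ᗮ ∧ q ∈ (Submodule.span ℝ {ν})ᗮ := fun q hq =>
      ⟨Submodule.orthogonal_le le_sup_left hq, Submodule.orthogonal_le le_sup_right hq⟩
    refine ⟨h.add_smul_mem_distLevel hx hν hν1 hs hsr, ?_,
      h.isInteriorUnitNormal_iff hx hν hν1 hs hsr, fun w κ hw => ?_, ?_, fun q hq w hw => ?_,
      fun v β hv => ⟨h.one_add_mul_pos hM hx hν hν1 hs hsr hv, ?_, fun hv1 => ?_⟩,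
      fun v hv hv1 => h.sffAlong_distLevel_lt hM hx hν hν1 hs hsr hv hv1⟩
    · rw [hsup, h.tangentSpace_distLevel_add_smul hx hν hν1 hs hsr]
    · rcases h.mem_orthogonal_or_isPrincipalDirection hM hx hν hν1 hs hsr hw with hQ | ⟨β, hβ⟩
      · exact Or.inr hQ
      · exact Or.inl hβ.1
    · rintro s' hs' hsρ' w ⟨κ, hw⟩
      obtain ⟨r', π', hsr', h'⟩ := Tub.exists_isTubularProjection_of_lt hsρ' hMc ⟨x, hx⟩
      rcases h.mem_orthogonal_or_isPrincipalDirection hM hx hν hν1 hs hsr hw with hQ | ⟨β, hβ⟩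
      · have hT := h'.tangentSpace_distLevel_add_smul hx hν hν1 hs' hsr'
        refine ⟨1 / s', hT.symm ▸ (hnormal w hQ).2, hw.2.1, fun u hu => ?_⟩
        exact h'.sffAlong_distLevel_of_normal hx hν hν1 hs' hsr' (hnormal w hQ).1
          (hnormal w hQ).2 (hT ▸ hu)
      · exact ⟨_, h'.isPrincipalDirection_distLevel hM hx hν hν1 hs' hsr' hβ⟩
    · exact h.sffAlong_distLevel_of_normal hx hν hν1 hs hsr (hnormal q hq).1 (hnormal q hq).2
        (hsup ▸ hw)
    · exact h.isPrincipalDirection_distLevel hM hx hν hν1 hs hsr hv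
    · have hpr := h.isPrincipalDirection_distLevel hM hx hν hν1 hs hsr hv
      rw [hpr.2.2 v hpr.1, real_inner_self_eq_norm_sq, hv1, one_pow, mul_one]
  · rcases M.eq_empty_or_nonempty with he | hne
    · refine ⟨0, fun s _ _ x hx => ?_⟩
      rw [he] at hx
      exact hx.elim
    · obtain ⟨r, π, hδr, h⟩ := Tub.exists_isTubularProjection_of_lt hδ hMc hne
      exact ⟨(r - δ)⁻¹, fun s hs hsδ x hx ν hν hν1 v hv w hw =>
        h.abs_sffAlong_distLevel_le hM hx hν hν1 hs hsδ hδr hv hw⟩
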